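/- Let $n\ge 1$ be an integer. (Pseudo-process.) Let $X_{2n}$ be the pseudo-process started at $0$ with sign-varying transition density $$p_{2n}(x,s)=\frac1{2\pi}\int_{-\infty}^{\infty}e^{-i\beta x}\,e^{-s\beta^{2n}}\,d\beta,\qquad x\in\mathbb R,\ s>0,$$ that is, for $0<\tau_1<\dots<\tau_m$ the cylinder $\{(X_{2n}(\tau_1),\dots,X_{2n}(\tau_m))\in B\}$ has signed measure $\int_B\prod_{j=1}^m p_{2n}(x_j-x_{j-1},\tau_j-\tau_{j-1})\,dx$ (with $x_0=0$, $\tau_0=0$). Then $\mathbb E\,e^{i\beta X_{2n}(s)}=e^{-s\beta^{2n}}$ for all $\beta\in\mathbb R$, $s>0$. (Composition.) Let $S_{1/(2n)}$ be a stable subordinator of order $\frac1{2n}$, normalised by $\mathbb E\,e^{-\lambda S_{1/(2n)}(t)}=e^{-t\lambda^{1/(2n)}}$ for $\lambda,t>0$, and define the law of the composition with the independent time $S_{1/(2n)}(t)$ by $$\Pr\{X_{2n}(S_{1/(2n)}(t))\in A\}=\int_0^\infty \Pr\{X_{2n}(s)\in A\}\,\Pr\{S_{1/(2n)}(t)\in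 ds\}$$ for Borel sets $A\subseteq\mathbb R$. Then for every $t>0$ this integral converges absolutely, and $X_{2n}(S_{1/(2n)}(t))$ has the symmetric Cauchy density $$u(x,t)=\int_0^\infty p_{2n}(x,s)\,\Pr\{S_{1/(2n)}(t)\in ds\}=\frac{t}{\pi(x^2+t^2)},\qquad x\in\mathbb R,$$ where the integral in the middle converges absolutely for every $x$. (Equation.) The function $u(x,t)=\dfrac{t}{\pi(x^2+t^2)}$ is smooth on $\mathbb R\times(0,\infty)$ and solves $$\frac{\partial^{2n}u}{\partial t^{2n}}=(-1)^n\frac{\partial^{2n}u}{\partial x^{2n}},\qquad x\in\mathbb R,\ t>0,$$ with initial conditions $u(x,0)=\delta(x)$, meaning $\lim_{t\to0^+}\int_{\mathbb R}f(x)u(x,t)\,dx=f(0)$ for every bounded continuous $f:\mathbb R\to\mathbb R$, and $$\lim_{t\to0^+}\frac{\partial^k u}{\partial t^k}(x,t)=\frac{(-1)^k\,k!}{\pi|x|^{k+1}}\cos\frac{\pi(k+1)}2,\qquad 0<k<2n,\ x\neq0 .$$ -/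

import Mathlib

open MeasureTheory ProbabilityTheory Filter Topology
open scoped NNReal BoundedContinuousFunction

noncomputable section

/-- The sign-varying transition density of the pseudo-process `X_{2n}`:
`p_{2n}(x, s) = (1 / 2π) ∫ e^{-iβx} e^{-s β^{2n}} dβ` for `s > 0`. The integral is a real number
(see `ofReal_pseudoDensity`), so that taking the real part only changes its type. -/
def pseudoDensity (n : ℕ) (x s : ℝ) : ℝ :=
  ((2 * Real.pi : ℂ)⁻¹ *
    ∫ β : ℝ, Complex.exp (-(Complex.I * β * x)) * Complex.exp (-((s : ℂ) * (β : ℂ) ^ (2 * n)))).re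

theorem ofReal_pseudoDensity (n : ℕ) (x s : ℝ) :
    (pseudoDensity n x s : ℂ) = (2 * Real.pi : ℂ)⁻¹ *
      ∫ β : ℝ, Complex.exp (-(Complex.I * β * x)) *
        Complex.exp (-((s : ℂ) * (β : ℂ) ^ (2 * n))) := by
  unfold pseudoDensity
  apply Complex.conj_eq_iff_re.mp
  rw [map_mul, ← integral_conj, ← integral_neg_eq_self]
  congr 1
  · rw [map_inv₀, map_mul, Complex.conj_ofReal, Complex.conj_ofNat]
  · congr 1
    funext β
    rw [map_mul, ← Complex.exp_conj, ← Complex.exp_conj]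
    simp [Even.neg_pow (even_two_mul n)]

/-- The increments `x_j - x_{j-1}`, with the convention `x_{-1} = 0`. -/
def increment {m : ℕ} (x : Fin m → ℝ) (j : Fin m) : ℝ :=
  x j - (Fin.cons 0 x : Fin (m + 1) → ℝ) j.castSucc

/-- The finite-dimensional law of the pseudo-process `X_{2n}` started at `0`: the signed measure
that the cylinder `{(X(τ_0), …, X(τ_{m-1})) ∈ B}`, `0 < τ_0 < ⋯ < τ_{m-1}`, receives is
`∫_B ∏_j p_{2n}(x_j - x_{j-1}, τ_j - τ_{j-1}) dx`. -/
def pseudoCylinder (n : ℕ) {m : ℕ} (τ : Fin m → ℝ) : SignedMeasure (Fin m → ℝ) :=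
  (volume : Measure (Fin m → ℝ)).withDensityᵥ
    (fun x => ∏ j, pseudoDensity n (increment x j) (increment τ j))

/-- The law of `X_{2n}(s)` for `s > 0`: the signed measure `A ↦ Pr{X_{2n}(s) ∈ A}` given by the
cylinders over the single time `s`. -/
def pseudoLaw (n : ℕ) (s : ℝ) : SignedMeasure ℝ :=
  (pseudoCylinder n (fun _ : Fin 1 => s)).map (fun x => x 0)

/-- `S` is a stable subordinator of order `α`, normalised by
`E e^{-l S(t)} = e^{-t l^α}` for `l, t > 0`. -/
structure IsStableSubordinator {Ω : Type*} [MeasurableSpace Ω] (α : ℝ) (S : ℝ≥0 → Ω → ℝ)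
    (P : Measure Ω) : Prop where
  measurable : ∀ t, Measurable (S t)
  start : ∀ᵐ ω ∂P, S 0 ω = 0
  monotone : ∀ᵐ ω ∂P, Monotone fun t => S t ω
  rightContinuous : ∀ᵐ ω ∂P, ∀ t, ContinuousWithinAt (fun r => S r ω) (Set.Ici t) t
  indepIncrements : HasIndepIncrements S P
  stationary : ∀ r h, IdentDistrib (fun ω => S (r + h) ω - S r ω) (S h) P P
  laplace : ∀ t : ℝ≥0, 0 < t → ∀ l : ℝ, 0 < l →
    ∫ ω, Real.exp (-(l * S t ω)) ∂P = Real.exp (-(t * l ^ α))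

/-- `Pr{X_{2n}(T) ∈ A}` for a random time `T > 0` independent of `X_{2n}`:
the integral of `Pr{X_{2n}(s) ∈ A}` against `Pr{T ∈ ds}`. -/
def composedProb {Ω : Type*} [MeasurableSpace Ω] (n : ℕ) (P : Measure Ω) (T : Ω → ℝ)
    (A : Set ℝ) : ℝ :=
  ∫ ω, pseudoLaw n (T ω) A ∂P

/-- The symmetric Cauchy density with scale `t`. -/
def cauchyDensity (x t : ℝ) : ℝ := t / (Real.pi * (x ^ 2 + t ^ 2))

end

/-! The composition is a subordination computed on the Fourier side. The Laplace transform of the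
subordinator at `β ^ (2n)` is `e^{-t (β^{2n})^{1/(2n)}} = e^{-t|β|}`
(`IsStableSubordinator.laplace_pow`), and inverse Fourier transformation of this gives the Cauchy
density (`integral_exp_mul_exp_neg_mul_abs`). Two applications of Fubini justify the exchange. For
fixed `x`, the kernel has modulus `e^{-s β^{2n}}`, whose mean `e^{-t|β|}` is integrable in `β`. For
a Borel set, the L¹ norm of `p_{2n}(·, s)` does not depend on `s`, by scaling
(`integral_norm_pseudoDensity`). The characteristic function of `X_{2n}(s)` is Fourier inversion,
once `p_{2n}(·, s)` is known to be integrable. For the equation, `u = π⁻¹ Re (t + ix)⁻¹`: each `∂_x`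
acts on `(t + ix)⁻¹` as `i ∂_t`, and `i^{2n} = (-1)^n`. The same closed form gives the limits of the
time derivatives. -/

/-! ### Derivatives of the Cauchy kernel -/

theorem cauchyDensity_eq_re_inv (x t : ℝ) :
    cauchyDensity x t = Real.pi⁻¹ * ((t + x * Complex.I : ℂ)⁻¹).re := by
  have h : Complex.normSq (t + x * Complex.I : ℂ) = x ^ 2 + t ^ 2 := by
    rw [Complex.normSq_add_mul_I]; ring
  rw [cauchyDensity, Complex.inv_re, h]
  simp only [Complex.add_re, Complex.ofReal_re, Complex.mul_re, Complex.I_re, Complex.ofReal_im,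
    Complex.I_im, mul_zero, mul_one, sub_self, add_zero]
  rw [← div_div]
  ring

/-- Derivatives of the real part of the reciprocal of an affine function. -/
theorem iteratedDeriv_re_inv_affine (c d : ℂ) (a : ℝ) (k : ℕ) :
    ∀ r : ℝ, c * r + d ≠ 0 →
      iteratedDeriv k (fun r : ℝ => a * ((c * r + d)⁻¹).re) r =
        a * ((-1) ^ k * k.factorial * c ^ k * ((c * r + d) ^ (k + 1))⁻¹).re := by
  induction k with
  | zero => intro r _; simp
  | succ k ih =>
    intro r hr
    rw [iteratedDeriv_succ]
    have hcont : Continuous fun r : ℝ => c * (r : ℂ) + d := by fun_prop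
    have hev : iteratedDeriv k (fun r : ℝ => a * ((c * r + d)⁻¹).re) =ᶠ[𝓝 r]
        fun r : ℝ => a * ((-1) ^ k * k.factorial * c ^ k * ((c * r + d) ^ (k + 1))⁻¹).re := by
      filter_upwards [hcont.continuousAt.eventually_ne hr] with y hy using ih y hy
    rw [hev.deriv_eq]
    have h1 : HasDerivAt (fun z : ℂ => c * z + d) c (r : ℂ) := by
      simpa using ((hasDerivAt_id (r : ℂ)).const_mul c).add_const d
    have h2 : HasDerivAt
        (fun z : ℂ => (-1) ^ k * k.factorial * c ^ k * ((c * z + d) ^ (k + 1))⁻¹)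
        ((-1) ^ (k + 1) * (k + 1).factorial * c ^ (k + 1) * ((c * r + d) ^ (k + 2))⁻¹)
        (r : ℂ) := by
      refine (((h1.pow (k + 1)).fun_inv (pow_ne_zero _ hr)).const_mul
        ((-1) ^ k * k.factorial * c ^ k)).congr_deriv ?_
      simp only [Nat.factorial_succ, Nat.add_sub_cancel, Pi.pow_apply]
      push_cast
      field_simp
      ring
    exact (h2.real_of_complex.const_mul a).deriv

theorem add_mul_I_ne_zero {x t : ℝ} (h : x ≠ 0 ∨ t ≠ 0) : (t + x * Complex.I : ℂ) ≠ 0 := by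
  intro h0
  have hre := congrArg Complex.re h0
  have him := congrArg Complex.im h0
  simp at hre him
  tauto

theorem iteratedDeriv_cauchyDensity_time (k : ℕ) {x t : ℝ} (h : x ≠ 0 ∨ t ≠ 0) :
    iteratedDeriv k (fun r => cauchyDensity x r) t = Real.pi⁻¹ *
      ((-1) ^ k * k.factorial * ((t + x * Complex.I : ℂ) ^ (k + 1))⁻¹).re := by
  have := iteratedDeriv_re_inv_affine 1 (x * Complex.I) Real.pi⁻¹ k t
    (by simpa using add_mul_I_ne_zero h)
  simpa [cauchyDensity_eq_re_inv] using this

theorem iteratedDeriv_cauchyDensity_space (k : ℕ) {x t : ℝ} (h : x ≠ 0 ∨ t ≠ 0) :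
    iteratedDeriv k (fun y => cauchyDensity y t) x = Real.pi⁻¹ *
      ((-1) ^ k * k.factorial * Complex.I ^ k * ((t + x * Complex.I : ℂ) ^ (k + 1))⁻¹).re := by
  have key (y : ℝ) : (t + y * Complex.I : ℂ) = Complex.I * y + t := by ring
  have := iteratedDeriv_re_inv_affine Complex.I t Real.pi⁻¹ k x
    (by simpa [← key] using add_mul_I_ne_zero h)
  simpa only [cauchyDensity_eq_re_inv, key] using this

theorem cauchyDensity_higherOrderLaplace (n : ℕ) {x t : ℝ} (ht : 0 < t) :
    iteratedDeriv (2 * n) (fun r => cauchyDensity x r) t =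
      (-1) ^ n * iteratedDeriv (2 * n) (fun y => cauchyDensity y t) x := by
  rw [iteratedDeriv_cauchyDensity_time _ (Or.inr ht.ne'),
    iteratedDeriv_cauchyDensity_space _ (Or.inr ht.ne'), pow_mul Complex.I, Complex.I_sq,
    show ∀ z : ℂ, (-1) ^ (2 * n) * ((2 * n).factorial : ℂ) * (-1) ^ n * z =
      (((-1) ^ n : ℝ) : ℂ) * ((-1) ^ (2 * n) * ((2 * n).factorial : ℂ) * z) from
        fun z => by push_cast; ring, Complex.re_ofReal_mul,
    mul_left_comm Real.pi⁻¹, ← mul_assoc ((-1 : ℝ) ^ n), ← mul_pow]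
  norm_num

theorem contDiffOn_cauchyDensity :
    ContDiffOn ℝ (⊤ : ℕ∞) (fun q : ℝ × ℝ => cauchyDensity q.1 q.2) {q | 0 < q.2} := by
  unfold cauchyDensity
  refine ContDiffOn.div (by fun_prop) (by fun_prop) fun q hq => ?_
  have : 0 < q.2 := hq
  positivity

theorem cauchyDensity_abs (x t : ℝ) : cauchyDensity |x| t = cauchyDensity x t := by
  simp [cauchyDensity]

theorem re_inv_mul_I_pow (y : ℝ) (m : ℕ) :
    (((y * Complex.I : ℂ) ^ m)⁻¹).re = (y ^ m)⁻¹ * Real.cos (Real.pi * m / 2) := by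
  have hI : (Complex.I ^ m)⁻¹ = Complex.exp ((-(Real.pi * m / 2) : ℝ) * Complex.I) := by
    rw [← inv_pow, Complex.inv_I, ← Complex.exp_neg_pi_div_two_mul_I, ← Complex.exp_nat_mul]
    congr 1
    push_cast
    ring
  rw [mul_pow, mul_inv, hI, ← Complex.ofReal_pow, ← Complex.ofReal_inv, Complex.re_ofReal_mul,
    Complex.exp_ofReal_mul_I_re, Real.cos_neg]

/-- When `x ≠ 0`, `t + ix` vanishes for no real `t`, so the closed form of the derivative is
continuous at `t = 0` and the limit is its value there. -/
theorem tendsto_iteratedDeriv_cauchyDensity_time (k : ℕ) {x : ℝ} (hx : x ≠ 0) :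
    Tendsto (fun t => iteratedDeriv k (fun r => cauchyDensity x r) t) (𝓝[>] 0)
      (𝓝 ((-1) ^ k * (k.factorial : ℝ) / (Real.pi * |x| ^ (k + 1)) *
        Real.cos (Real.pi * (k + 1) / 2))) := by
  have hx' : |x| ≠ 0 := abs_ne_zero.2 hx
  have hfun : (fun t => iteratedDeriv k (fun r => cauchyDensity x r) t) = fun t : ℝ =>
      Real.pi⁻¹ *
        ((-1) ^ k * k.factorial * ((t + |x| * Complex.I : ℂ) ^ (k + 1))⁻¹).re := by
    funext t
    -- Evenness in `x` makes `|x|` appear in the limit without a case split on sign.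
    simp_rw [← cauchyDensity_abs x]
    exact iteratedDeriv_cauchyDensity_time k (Or.inl hx')
  have hval : (-1) ^ k * (k.factorial : ℝ) / (Real.pi * |x| ^ (k + 1)) *
        Real.cos (Real.pi * (k + 1) / 2) = Real.pi⁻¹ *
        ((-1) ^ k * k.factorial * (((0 : ℝ) + |x| * Complex.I : ℂ) ^ (k + 1))⁻¹).re := by
    have := re_inv_mul_I_pow |x| (k + 1)
    rw [show ((-1 : ℂ) ^ k * k.factorial) = (((-1) ^ k * k.factorial : ℝ) : ℂ) by push_cast; ring,
      Complex.re_ofReal_mul, Complex.ofReal_zero, zero_add, this]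
    push_cast
    field_simp
  rw [hfun, hval]
  refine Tendsto.mono_left (ContinuousAt.tendsto (f := fun t : ℝ => Real.pi⁻¹ *
    ((-1) ^ k * k.factorial * ((t + |x| * Complex.I : ℂ) ^ (k + 1))⁻¹).re) ?_) nhdsWithin_le_nhds
  refine continuousAt_const.mul (Complex.continuous_re.continuousAt.comp
    (continuousAt_const.mul (ContinuousAt.inv₀ (by fun_prop) ?_)))
  exact pow_ne_zero _ (add_mul_I_ne_zero (Or.inl hx'))

/-! ### The initial condition `u(x, 0) = δ(x)` -/

theorem integral_mul_cauchyDensity (f : ℝ → ℝ) {t : ℝ} (ht : 0 < t) :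
    ∫ x, f x * cauchyDensity x t = ∫ y, f (t * y) * (Real.pi⁻¹ * (1 + y ^ 2)⁻¹) := by
  have := Measure.integral_comp_mul_left (fun x => f x * cauchyDensity x t) t
  rw [abs_of_pos (inv_pos.2 ht), smul_eq_mul, eq_inv_mul_iff_mul_eq₀ ht.ne',
    ← integral_const_mul] at this
  rw [← this]
  congr 1
  funext y
  rw [cauchyDensity]
  field_simp
  ring

theorem tendsto_integral_mul_cauchyDensity (f : ℝ →ᵇ ℝ) :
    Tendsto (fun t => ∫ x, f x * cauchyDensity x t) (𝓝[>] 0) (𝓝 (f 0)) := by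
  have hone : f 0 = ∫ y : ℝ, f 0 * (Real.pi⁻¹ * (1 + y ^ 2)⁻¹) := by
    rw [integral_const_mul, integral_const_mul, integral_univ_inv_one_add_sq,
      inv_mul_cancel₀ Real.pi_ne_zero, mul_one]
  have hlim : Tendsto (fun t : ℝ => ∫ y : ℝ, f (t * y) * (Real.pi⁻¹ * (1 + y ^ 2)⁻¹)) (𝓝[>] 0)
      (𝓝 (f 0)) := by
    rw [hone]
    refine tendsto_integral_filter_of_dominated_convergence
      (fun y => ‖f‖ * (Real.pi⁻¹ * (1 + y ^ 2)⁻¹)) (Eventually.of_forall fun t => ?_)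
      (Eventually.of_forall fun t => Eventually.of_forall fun y => ?_)
      ((integrable_inv_one_add_sq.const_mul _).const_mul _) (Eventually.of_forall fun y => ?_)
    · have : Continuous fun y : ℝ => f (t * y) := f.continuous.comp (by fun_prop)
      exact this.aestronglyMeasurable.mul (by fun_prop)
    · have hpos : 0 ≤ Real.pi⁻¹ * (1 + y ^ 2)⁻¹ := by positivity
      rw [norm_mul, Real.norm_of_nonneg hpos]
      exact mul_le_mul_of_nonneg_right (f.norm_coe_le_norm _) hpos
    · have : Continuous fun t : ℝ => f (t * y) := f.continuous.comp (by fun_prop)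
      have h0 := this.tendsto 0
      rw [zero_mul] at h0
      exact (h0.mono_left nhdsWithin_le_nhds).mul_const _
  refine hlim.congr' ?_
  filter_upwards [self_mem_nhdsWithin] with t ht
  exact (integral_mul_cauchyDensity f ht).symm

/-! ### Integrability of the pseudo-density and Fourier inversion -/

open scoped FourierTransform in
/-- A function on the line with two integrable derivatives has an integrable Fourier transform. -/
theorem integrable_fourier_of_integrable_deriv_two {f : ℝ → ℂ} (hf : Integrable f)
    (hd : Differentiable ℝ f) (hf' : Integrable (deriv f)) (hd' : Differentiable ℝ (deriv f))
    (hf'' : Integrable (deriv (deriv f))) : Integrable (𝓕 f) := by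
  have hcont : Continuous (𝓕 f) :=
    VectorFourier.fourierIntegral_continuous Real.continuous_fourierChar
      (by exact continuous_inner) hf
  have hnorm (g : ℝ → ℂ) (ξ : ℝ) : ‖𝓕 g ξ‖ ≤ ∫ v, ‖g v‖ :=
    VectorFourier.norm_fourierIntegral_le_integral_norm _ _ _ _ _
  -- The bound is `(1 + ξ²) ‖𝓕 f ξ‖ ≤ ‖f‖₁ + ‖f''‖₁`; the factor `(2π)² ≥ 1` coming from `f''` is
  -- discarded.
  refine Integrable.mono' (integrable_inv_one_add_sq.const_mul
    ((∫ v, ‖f v‖) + ∫ v, ‖deriv (deriv f) v‖)) hcont.aestronglyMeasurable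
    (Eventually.of_forall fun ξ => ?_)
  have h2 : ‖𝓕 (deriv (deriv f)) ξ‖ = (2 * Real.pi) ^ 2 * ξ ^ 2 * ‖𝓕 f ξ‖ := by
    rw [Real.fourier_deriv hf' hd' hf'', Real.fourier_deriv hf hd hf']
    simp only [smul_eq_mul, norm_mul, Complex.norm_ofNat, Complex.norm_real, Complex.norm_I,
      Real.norm_eq_abs, abs_of_pos Real.pi_pos]
    rw [← sq_abs ξ]
    ring
  have h0 := hnorm f ξ
  have h3 := hnorm (deriv (deriv f)) ξ
  have hpi : 1 ≤ (2 * Real.pi) ^ 2 := one_le_pow₀ (by linarith [Real.pi_gt_three])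
  have h4 : ξ ^ 2 * ‖𝓕 f ξ‖ ≤ (2 * Real.pi) ^ 2 * ξ ^ 2 * ‖𝓕 f ξ‖ := by
    rw [mul_assoc]
    exact le_mul_of_one_le_left (by positivity) hpi
  rw [← div_eq_mul_inv, le_div_iff₀ (by positivity)]
  linarith

/-- Gives the Gaussian majorant `e^{-s b^{2n}} ≤ e^s e^{-s b²}`, uniformly in `n ≥ 1`. -/
theorem sq_sub_one_le_pow_two_mul {n : ℕ} (hn : 1 ≤ n) (b : ℝ) : b ^ 2 - 1 ≤ b ^ (2 * n) := by
  rw [pow_mul]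
  rcases le_total (b ^ 2) 1 with h | h
  · exact le_trans (by linarith) (pow_nonneg (sq_nonneg b) n)
  · exact le_trans (by linarith) (le_self_pow₀ h (by omega))

theorem norm_exp_neg_mul_pow (n : ℕ) (s b : ℝ) :
    ‖Complex.exp (-((s : ℂ) * (b : ℂ) ^ (2 * n)))‖ = Real.exp (-(s * b ^ (2 * n))) := by
  rw [show -((s : ℂ) * (b : ℂ) ^ (2 * n)) = ((-(s * b ^ (2 * n)) : ℝ) : ℂ) by push_cast; ring,
    Complex.norm_exp_ofReal]

theorem integrable_pow_mul_exp_neg_mul_pow {n : ℕ} (hn : 1 ≤ n) {s : ℝ} (hs : 0 < s) (k : ℕ) :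
    Integrable fun b : ℝ => (b : ℂ) ^ k * Complex.exp (-((s : ℂ) * (b : ℂ) ^ (2 * n))) := by
  have hg := (integrable_rpow_mul_exp_neg_mul_sq hs (s := k)
    (by linarith [(Nat.cast_nonneg k : (0 : ℝ) ≤ k)])).norm.const_mul (Real.exp s)
  refine Integrable.mono' hg (by fun_prop) (Eventually.of_forall fun b => ?_)
  rw [norm_mul, norm_exp_neg_mul_pow, norm_pow, Complex.norm_real, norm_mul, Real.rpow_natCast,
    norm_pow, Real.norm_of_nonneg (Real.exp_pos _).le, mul_left_comm, ← Real.exp_add]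
  gcongr
  nlinarith [sq_sub_one_le_pow_two_mul hn b]

theorem integrable_exp_neg_mul_pow {n : ℕ} (hn : 1 ≤ n) {s : ℝ} (hs : 0 < s) :
    Integrable fun b : ℝ => Complex.exp (-((s : ℂ) * (b : ℂ) ^ (2 * n))) := by
  simpa using integrable_pow_mul_exp_neg_mul_pow hn hs 0

theorem hasDerivAt_pow_mul_exp_neg_mul_pow (n k : ℕ) (s b : ℝ) :
    HasDerivAt (fun b : ℝ => (b : ℂ) ^ k * Complex.exp (-((s : ℂ) * (b : ℂ) ^ (2 * n))))
      (k * ((b : ℂ) ^ (k - 1) * Complex.exp (-((s : ℂ) * (b : ℂ) ^ (2 * n)))) -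
        (s * (2 * n : ℕ)) * ((b : ℂ) ^ (k + (2 * n - 1)) *
          Complex.exp (-((s : ℂ) * (b : ℂ) ^ (2 * n))))) b := by
  have h1 : HasDerivAt (fun z : ℂ => -((s : ℂ) * z ^ (2 * n)))
      (-((s : ℂ) * ((2 * n : ℕ) * (b : ℂ) ^ (2 * n - 1)))) (b : ℂ) :=
    ((hasDerivAt_pow (2 * n) (b : ℂ)).const_mul _).neg
  refine (((hasDerivAt_pow k (b : ℂ)).mul h1.cexp).comp_ofReal).congr_deriv ?_
  ring

open scoped FourierTransform in
theorem integrable_fourier_exp_neg_mul_pow {n : ℕ} (hn : 1 ≤ n) {s : ℝ} (hs : 0 < s) :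
    Integrable (𝓕 fun b : ℝ => Complex.exp (-((s : ℂ) * (b : ℂ) ^ (2 * n)))) := by
  have hd (b : ℝ) : HasDerivAt (fun b : ℝ => Complex.exp (-((s : ℂ) * (b : ℂ) ^ (2 * n))))
      (-(s * (2 * n : ℕ)) * ((b : ℂ) ^ (2 * n - 1) *
          Complex.exp (-((s : ℂ) * (b : ℂ) ^ (2 * n))))) b := by
    simpa using hasDerivAt_pow_mul_exp_neg_mul_pow n 0 s b
  have hderiv := funext fun b => (hd b).deriv
  have hd' (b : ℝ) := (hasDerivAt_pow_mul_exp_neg_mul_pow n (2 * n - 1) s b).const_mul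
    (-((s : ℂ) * (2 * n : ℕ)))
  refine integrable_fourier_of_integrable_deriv_two (integrable_exp_neg_mul_pow hn hs)
    (fun b => (hd b).differentiableAt) ?_ ?_ ?_
  · rw [hderiv]
    exact (integrable_pow_mul_exp_neg_mul_pow hn hs _).const_mul _
  · rw [hderiv]
    exact fun b => (hd' b).differentiableAt
  · rw [hderiv, funext fun b => (hd' b).deriv]
    exact (((integrable_pow_mul_exp_neg_mul_pow hn hs _).const_mul _).sub
      ((integrable_pow_mul_exp_neg_mul_pow hn hs _).const_mul _)).const_mul _

open scoped FourierTransform in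
theorem ofReal_pseudoDensity_eq_fourier (n : ℕ) (x s : ℝ) :
    (pseudoDensity n x s : ℂ) = (2 * Real.pi : ℂ)⁻¹ *
      𝓕 (fun b : ℝ => Complex.exp (-((s : ℂ) * (b : ℂ) ^ (2 * n)))) (x / (2 * Real.pi)) := by
  rw [ofReal_pseudoDensity, Real.fourier_real_eq_integral_exp_smul]
  congr 2
  funext b
  rw [smul_eq_mul]
  congr 2
  push_cast
  field_simp

theorem integrable_pseudoDensity {n : ℕ} (hn : 1 ≤ n) {s : ℝ} (hs : 0 < s) :
    Integrable fun x => pseudoDensity n x s := by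
  have h := (((integrable_fourier_exp_neg_mul_pow hn hs).comp_div
    (R := 2 * Real.pi) (by positivity)).const_mul (2 * Real.pi : ℂ)⁻¹).re
  refine h.congr (Eventually.of_forall fun x => ?_)
  simp only [← ofReal_pseudoDensity_eq_fourier]
  simp

open scoped FourierTransform in
/-- The characteristic function of the pseudo-process at time `s`. -/
theorem integral_exp_mul_pseudoDensity {n : ℕ} (hn : 1 ≤ n) {s : ℝ} (hs : 0 < s) (b : ℝ) :
    ∫ x : ℝ, pseudoDensity n x s • Complex.exp (Complex.I * b * x) =
      Complex.exp (-((s : ℂ) * (b : ℂ) ^ (2 * n))) := by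
  have hinv := congrFun (Continuous.fourierInv_fourier_eq (by fun_prop)
    (integrable_exp_neg_mul_pow hn hs) (integrable_fourier_exp_neg_mul_pow hn hs)) b
  rw [Real.fourierInv_eq'] at hinv
  have hscale := Measure.integral_comp_mul_left
    (fun x : ℝ => pseudoDensity n x s • Complex.exp (Complex.I * b * x)) (2 * Real.pi)
  rw [abs_of_pos (by positivity), eq_inv_smul_iff₀ (by positivity)] at hscale
  rw [← hscale, ← hinv, ← integral_smul]
  congr 1
  funext ξ
  rw [Complex.real_smul, Complex.real_smul, ofReal_pseudoDensity_eq_fourier,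
    mul_div_cancel_left₀ _ (by positivity : (2 * Real.pi : ℝ) ≠ 0), smul_eq_mul,
    show Complex.I * b * ((2 * Real.pi * ξ : ℝ) : ℂ) =
      ((2 * Real.pi * inner ℝ ξ b : ℝ) : ℂ) * Complex.I by
        simp only [RCLike.inner_apply, conj_trivial]; push_cast; ring]
  push_cast
  have : (Real.pi : ℂ) ≠ 0 := by exact_mod_cast Real.pi_ne_zero
  field_simp

/-! ### The one-time signed law and its characteristic function -/

/-- Integration against a signed measure with density. -/
theorem integral_withDensityᵥ_eq_integral_smul {X : Type*} [MeasurableSpace X] {μ : Measure X}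
    {g : X → ℝ} (hgm : Measurable g) (hg : Integrable g μ) {f : X → ℂ} (hf : Measurable f)
    {C : ℝ} (hC : ∀ x, ‖f x‖ ≤ C) :
    ∫ᵛ x, f x ∂<•(μ.withDensityᵥ g) = ∫ x, g x • f x ∂μ := by
  have h1 := isFiniteMeasure_withDensity_ofReal hg.2
  have h2 : IsFiniteMeasure (μ.withDensity fun x => ENNReal.ofReal (-g x)) :=
    isFiniteMeasure_withDensity_ofReal hg.neg.2
  have hint (ν : Measure X) [IsFiniteMeasure ν] : ν.toSignedMeasure.Integrable f := by
    simp only [VectorMeasure.Integrable, Measure.variation_toSignedMeasure]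
    exact Integrable.of_bound hf.aestronglyMeasurable C (Eventually.of_forall hC)
  have hgm' : Measurable fun x => -g x := hgm.neg
  have hg' : Integrable (fun x => -g x) μ := hg.neg
  have hpart {h : X → ℝ} (hm : Measurable h) (hi : Integrable h μ) :
      ∫ x, f x ∂(μ.withDensity fun x => ENNReal.ofReal (h x)) =
        ∫ x, max (h x) 0 • f x ∂μ ∧ Integrable (fun x => max (h x) 0 • f x) μ := by
    refine ⟨?_, ?_⟩
    · rw [integral_withDensity_eq_integral_toReal_smul (by fun_prop) (by simp)]
      simp only [ENNReal.toReal_ofReal']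
    · exact hi.pos_part.smul_bdd C hf.aestronglyMeasurable (Eventually.of_forall hC)
  -- The signed measure splits into two finite positive measures, with densities `g⁺` and `g⁻`; then
  -- `g⁺ - g⁻ = g`.
  rw [withDensityᵥ_eq_withDensity_pos_part_sub_withDensity_neg_part hg,
    VectorMeasure.integral_sub_vectorMeasure (hint _) (hint _),
    VectorMeasure.integral_toSignedMeasure, VectorMeasure.integral_toSignedMeasure,
    (hpart hgm hg).1, (hpart hgm' hg').1,
    ← integral_sub (hpart hgm hg).2 (hpart hgm' hg').2]
  congr 1
  funext x
  rw [← sub_smul]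
  congr 1
  rcases le_total 0 (g x) with h | h
  · simp [h]
  · simp [h]

theorem measurable_pseudoDensity (n : ℕ) :
    Measurable fun q : ℝ × ℝ => pseudoDensity n q.1 q.2 := by
  unfold pseudoDensity
  have : StronglyMeasurable fun p : (ℝ × ℝ) × ℝ =>
      Complex.exp (-(Complex.I * p.2 * p.1.1)) *
        Complex.exp (-((p.1.2 : ℂ) * (p.2 : ℂ) ^ (2 * n))) := by
    fun_prop
  exact Complex.measurable_re.comp
    ((this.integral_prod_right' (ν := volume)).measurable.const_mul _)

theorem pseudoLaw_eq_withDensityᵥ {n : ℕ} (hn : 1 ≤ n) {s : ℝ} (hs : 0 < s) :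
    pseudoLaw n s = volume.withDensityᵥ fun x => pseudoDensity n x s := by
  have hmp : MeasurePreserving (MeasurableEquiv.funUnique (Fin 1) ℝ) volume volume :=
    volume_preserving_piUnique fun _ : Fin 1 => ℝ
  have hfun : (fun x : Fin 1 → ℝ => ∏ j, pseudoDensity n (increment x j)
      (increment (fun _ : Fin 1 => s) j)) =
      (fun x => pseudoDensity n x s) ∘ MeasurableEquiv.funUnique (Fin 1) ℝ := by
    funext x
    simp [increment, MeasurableEquiv.funUnique]
  have hi := integrable_pseudoDensity hn hs
  have hi' := hmp.integrable_comp_of_integrable hi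
  ext A hA
  rw [pseudoLaw, pseudoCylinder, hfun, VectorMeasure.map_apply _ (measurable_pi_apply 0) hA,
    withDensityᵥ_apply hi' (measurable_pi_apply 0 hA), withDensityᵥ_apply hi hA]
  exact hmp.setIntegral_preimage_emb (MeasurableEquiv.measurableEmbedding _)
    (fun x => pseudoDensity n x s) A

theorem pseudoLaw_apply {n : ℕ} (hn : 1 ≤ n) {s : ℝ} (hs : 0 < s) {A : Set ℝ}
    (hA : MeasurableSet A) : pseudoLaw n s A = ∫ x in A, pseudoDensity n x s := by
  rw [pseudoLaw_eq_withDensityᵥ hn hs, withDensityᵥ_apply (integrable_pseudoDensity hn hs) hA]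

theorem integral_exp_pseudoLaw {n : ℕ} (hn : 1 ≤ n) {s : ℝ} (hs : 0 < s) (b : ℝ) :
    ∫ᵛ x, Complex.exp (Complex.I * b * x) ∂<•(pseudoLaw n s) =
      Real.exp (-(s * b ^ (2 * n))) := by
  have hm : Measurable fun x => pseudoDensity n x s :=
    (measurable_pseudoDensity n).comp (f := fun x : ℝ => (x, s)) measurable_prodMk_right
  have hbound (x : ℝ) : ‖Complex.exp (Complex.I * b * x)‖ ≤ 1 := by
    rw [show Complex.I * b * x = ((b * x : ℝ) : ℂ) * Complex.I by push_cast; ring,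
      Complex.norm_exp_ofReal_mul_I]
  have hexp : Measurable fun x : ℝ => Complex.exp (Complex.I * b * x) := by fun_prop
  rw [pseudoLaw_eq_withDensityᵥ hn hs]
  refine (integral_withDensityᵥ_eq_integral_smul hm (integrable_pseudoDensity hn hs) hexp
    hbound).trans ((integral_exp_mul_pseudoDensity hn hs b).trans ?_)
  push_cast
  rfl

/-! ### Scaling, and the Fourier transform of `e^{-t|β|}` -/

theorem pseudoDensity_scale (n : ℕ) (x s : ℝ) {a : ℝ} (ha : 0 < a) :
    pseudoDensity n x s = a * pseudoDensity n (a * x) (s * a ^ (2 * n)) := by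
  have h := Measure.integral_comp_mul_left (fun b : ℝ => Complex.exp (-(Complex.I * b * x)) *
        Complex.exp (-((s : ℂ) * (b : ℂ) ^ (2 * n)))) a
  rw [abs_of_pos (inv_pos.2 ha), eq_inv_smul_iff₀ ha.ne'] at h
  rw [← Complex.ofReal_inj, Complex.ofReal_mul, ofReal_pseudoDensity, ofReal_pseudoDensity, ← h,
    Complex.real_smul, mul_left_comm]
  congr 4
  funext b
  push_cast
  ring_nf

theorem integral_norm_pseudoDensity {n : ℕ} (hn : 1 ≤ n) {s : ℝ} (hs : 0 < s) :
    ∫ x, ‖pseudoDensity n x s‖ = ∫ x, ‖pseudoDensity n x 1‖ := by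
  -- The scale `a = s^{-1/(2n)}` brings time `s` to time `1`.
  have ha : 0 < (s⁻¹) ^ (((2 * n : ℕ) : ℝ)⁻¹) := by positivity
  have hpow : ((s⁻¹) ^ (((2 * n : ℕ) : ℝ)⁻¹)) ^ (2 * n) = s⁻¹ :=
    Real.rpow_inv_natCast_pow (by positivity) (by omega)
  set a := (s⁻¹) ^ (((2 * n : ℕ) : ℝ)⁻¹)
  have h := Measure.integral_comp_mul_left (fun x => ‖pseudoDensity n x 1‖) a
  rw [abs_of_pos (inv_pos.2 ha), smul_eq_mul, eq_inv_mul_iff_mul_eq₀ ha.ne',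
    ← integral_const_mul] at h
  rw [← h]
  congr 1
  funext x
  rw [pseudoDensity_scale n x s ha, hpow, mul_inv_cancel₀ hs.ne', norm_mul,
    Real.norm_of_nonneg ha.le]

theorem integrable_exp_neg_mul_abs {t : ℝ} (ht : 0 < t) :
    Integrable fun b : ℝ => Real.exp (-(t * |b|)) := by
  rw [← integrableOn_univ, ← Set.Iic_union_Ioi (a := (0 : ℝ)), integrableOn_union]
  constructor
  · refine (integrableOn_exp_mul_Iic ht 0).congr_fun (fun b hb => ?_) measurableSet_Iic
    simp only [abs_of_nonpos (Set.mem_Iic.1 hb)]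
    ring_nf
  · refine (integrableOn_exp_mul_Ioi (neg_lt_zero.2 ht) 0).congr_fun (fun b hb => ?_)
      measurableSet_Ioi
    simp only [abs_of_pos (Set.mem_Ioi.1 hb)]
    ring_nf

/-- The Fourier transform of the two-sided exponential is the Cauchy density. -/
theorem integral_exp_mul_exp_neg_mul_abs (x : ℝ) {t : ℝ} (ht : 0 < t) :
    (2 * Real.pi : ℂ)⁻¹ * ∫ b : ℝ, Complex.exp (-(Complex.I * b * x)) *
      (Real.exp (-(t * |b|)) : ℂ) = cauchyDensity x t := by
  have hl : 0 < (t - Complex.I * x : ℂ).re := by simpa using ht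
  have hr : (-(t + Complex.I * x) : ℂ).re < 0 := by simpa using ht
  have hcl : Set.EqOn (fun b : ℝ => Complex.exp ((t - Complex.I * x) * b))
      (fun b : ℝ => Complex.exp (-(Complex.I * b * x)) * (Real.exp (-(t * |b|)) : ℂ))
      (Set.Iic 0) := fun b hb => by
    simp only [abs_of_nonpos (Set.mem_Iic.1 hb), Complex.ofReal_exp, ← Complex.exp_add]
    congr 1
    push_cast
    ring
  have hcr : Set.EqOn (fun b : ℝ => Complex.exp (-(t + Complex.I * x) * b))
      (fun b : ℝ => Complex.exp (-(Complex.I * b * x)) * (Real.exp (-(t * |b|)) : ℂ))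
      (Set.Ioi 0) := fun b hb => by
    simp only [abs_of_pos (Set.mem_Ioi.1 hb), Complex.ofReal_exp, ← Complex.exp_add]
    congr 1
    push_cast
    ring
  rw [← intervalIntegral.integral_Iic_add_Ioi
      ((integrableOn_exp_mul_complex_Iic hl 0).congr_fun hcl measurableSet_Iic)
      ((integrableOn_exp_mul_complex_Ioi hr 0).congr_fun hcr measurableSet_Ioi),
    ← setIntegral_congr_fun measurableSet_Iic hcl, ← setIntegral_congr_fun measurableSet_Ioi hcr,
    integral_exp_mul_complex_Iic hl, integral_exp_mul_complex_Ioi hr]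
  have h1 : (t - Complex.I * x : ℂ) ≠ 0 := fun h => by rw [h] at hl; simp at hl
  have h2 : (t + Complex.I * x : ℂ) ≠ 0 := fun h => by rw [h] at hr; simp at hr
  have hpi : (Real.pi : ℂ) ≠ 0 := by exact_mod_cast Real.pi_ne_zero
  have h3 : (x ^ 2 + t ^ 2 : ℂ) = (t - Complex.I * x) * (t + Complex.I * x) := by
    linear_combination (x : ℂ) ^ 2 * Complex.I_sq
  rw [cauchyDensity]
  push_cast
  rw [h3]
  simp only [mul_zero, Complex.exp_zero]
  field_simp
  ring

theorem pseudoLaw_randomTime_ae_eq {Ω : Type*} [MeasurableSpace Ω] {P : Measure Ω} {T : Ω → ℝ}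
    {n : ℕ} (hn : 1 ≤ n) (hpos : ∀ᵐ ω ∂P, 0 < T ω) {A : Set ℝ}
    (hA : MeasurableSet A) :
    (fun ω => ∫ x in A, pseudoDensity n x (T ω)) =ᵐ[P] fun ω => pseudoLaw n (T ω) A := by
  filter_upwards [hpos] with ω hω using (pseudoLaw_apply hn hω hA).symm

theorem norm_fourierKernel (n : ℕ) (x s b : ℝ) :
    ‖Complex.exp (-(Complex.I * b * x)) * Complex.exp (-((s : ℂ) * (b : ℂ) ^ (2 * n)))‖ =
      Real.exp (-(s * b ^ (2 * n))) := by
  rw [norm_mul, norm_exp_neg_mul_pow,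
    show -(Complex.I * b * x) = ((-(b * x) : ℝ) : ℂ) * Complex.I by push_cast; ring,
    Complex.norm_exp_ofReal_mul_I, one_mul]

/-! ### Evaluation at an independent random time -/

section RandomTime

variable {Ω : Type*} [MeasurableSpace Ω] {P : Measure Ω} [IsProbabilityMeasure P] {T : Ω → ℝ}
  {n : ℕ} {t : ℝ}

theorem integrable_exp_neg_mul_of_pos (hT : Measurable T) (hpos : ∀ᵐ ω ∂P, 0 < T ω) {l : ℝ}
    (hl : 0 ≤ l) : Integrable (fun ω => Real.exp (-(T ω * l))) P := by
  refine Integrable.of_bound (by fun_prop) 1 ?_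
  filter_upwards [hpos] with ω hω
  rw [Real.norm_of_nonneg (Real.exp_pos _).le, Real.exp_le_one_iff]
  exact neg_nonpos.2 (mul_nonneg hω.le hl)

/-- Integrating the modulus over `ω` first turns it into `e^{-t|β|}` by `hlap`, so no separate
moment bound on `T` is needed. -/
theorem integrable_fourierKernel_prod (hT : Measurable T) (hpos : ∀ᵐ ω ∂P, 0 < T ω) (ht : 0 < t)
    (hlap : ∀ b : ℝ, ∫ ω, Real.exp (-(T ω * b ^ (2 * n))) ∂P = Real.exp (-(t * |b|))) (x : ℝ) :
    Integrable (fun q : Ω × ℝ => Complex.exp (-(Complex.I * q.2 * x)) *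
      Complex.exp (-((T q.1 : ℂ) * (q.2 : ℂ) ^ (2 * n)))) (P.prod volume) := by
  have hmeas : Measurable fun q : Ω × ℝ => Complex.exp (-(Complex.I * q.2 * x)) *
      Complex.exp (-((T q.1 : ℂ) * (q.2 : ℂ) ^ (2 * n))) := by fun_prop
  rw [integrable_prod_iff' hmeas.aestronglyMeasurable]
  simp only [norm_fourierKernel, hlap]
  refine ⟨Eventually.of_forall fun b => ?_, integrable_exp_neg_mul_abs ht⟩
  refine Integrable.mono'
    (integrable_exp_neg_mul_of_pos hT hpos ((even_two_mul n).pow_nonneg b)) ?_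
    (Eventually.of_forall fun ω => (norm_fourierKernel n x (T ω) b).le)
  exact (hmeas.comp measurable_prodMk_right).aestronglyMeasurable

theorem integrable_pseudoDensity_randomTime (hT : Measurable T) (hpos : ∀ᵐ ω ∂P, 0 < T ω)
    (ht : 0 < t)
    (hlap : ∀ b : ℝ, ∫ ω, Real.exp (-(T ω * b ^ (2 * n))) ∂P = Real.exp (-(t * |b|))) (x : ℝ) :
    Integrable (fun ω => pseudoDensity n x (T ω)) P :=
  ((integrable_fourierKernel_prod hT hpos ht hlap x).integral_prod_left.const_mul
    (2 * Real.pi : ℂ)⁻¹).re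

theorem integral_pseudoDensity_randomTime (hT : Measurable T) (hpos : ∀ᵐ ω ∂P, 0 < T ω)
    (ht : 0 < t)
    (hlap : ∀ b : ℝ, ∫ ω, Real.exp (-(T ω * b ^ (2 * n))) ∂P = Real.exp (-(t * |b|))) (x : ℝ) :
    ∫ ω, pseudoDensity n x (T ω) ∂P = cauchyDensity x t := by
  rw [← Complex.ofReal_inj, ← integral_complex_ofReal, ← integral_exp_mul_exp_neg_mul_abs x ht]
  simp only [ofReal_pseudoDensity]
  rw [integral_const_mul,
    integral_integral_swap (integrable_fourierKernel_prod hT hpos ht hlap x)]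
  congr 2
  funext b
  rw [integral_const_mul, ← hlap b, ← integral_complex_ofReal]
  push_cast
  rfl

/-- The inner L¹ norm is almost surely the same constant, which is integrable because `P` is a
probability measure. -/
theorem integrable_pseudoDensity_prod (hn : 1 ≤ n) (hT : Measurable T)
    (hpos : ∀ᵐ ω ∂P, 0 < T ω) :
    Integrable (fun q : Ω × ℝ => pseudoDensity n q.2 (T q.1)) (P.prod volume) := by
  have hmeas : Measurable fun q : Ω × ℝ => pseudoDensity n q.2 (T q.1) :=
    (measurable_pseudoDensity n).comp (f := fun q : Ω × ℝ => (q.2, T q.1)) (by fun_prop)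
  rw [integrable_prod_iff hmeas.aestronglyMeasurable]
  constructor
  · filter_upwards [hpos] with ω hω using integrable_pseudoDensity hn hω
  · refine (integrable_const (∫ x, ‖pseudoDensity n x 1‖)).congr ?_
    filter_upwards [hpos] with ω hω using (integral_norm_pseudoDensity hn hω).symm

theorem integrable_pseudoDensity_prod_restrict (hn : 1 ≤ n) (hT : Measurable T)
    (hpos : ∀ᵐ ω ∂P, 0 < T ω) (A : Set ℝ) :
    Integrable (fun q : Ω × ℝ => pseudoDensity n q.2 (T q.1)) (P.prod (volume.restrict A)) := by
  have h := (integrable_pseudoDensity_prod hn hT hpos).restrict (s := Set.univ ×ˢ A)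
  rwa [← Measure.prod_restrict, Measure.restrict_univ] at h

theorem integrable_pseudoLaw_randomTime (hn : 1 ≤ n) (hT : Measurable T)
    (hpos : ∀ᵐ ω ∂P, 0 < T ω) {A : Set ℝ} (hA : MeasurableSet A) :
    Integrable (fun ω => pseudoLaw n (T ω) A) P :=
  (integrable_pseudoDensity_prod_restrict hn hT hpos A).integral_prod_left.congr
    (pseudoLaw_randomTime_ae_eq hn hpos hA)

theorem composedProb_eq_setIntegral_cauchyDensity (hn : 1 ≤ n) (hT : Measurable T)
    (hpos : ∀ᵐ ω ∂P, 0 < T ω) (ht : 0 < t)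
    (hlap : ∀ b : ℝ, ∫ ω, Real.exp (-(T ω * b ^ (2 * n))) ∂P = Real.exp (-(t * |b|)))
    {A : Set ℝ} (hA : MeasurableSet A) :
    composedProb n P T A = ∫ x in A, cauchyDensity x t := by
  rw [composedProb, ← integral_congr_ae (pseudoLaw_randomTime_ae_eq hn hpos hA),
    integral_integral_swap (integrable_pseudoDensity_prod_restrict hn hT hpos A)]
  simp only [integral_pseudoDensity_randomTime hT hpos ht hlap]

end RandomTime

/-! ### Positivity and Laplace transform of the subordinator -/

section Subordinator

variable {Ω : Type*} [MeasurableSpace Ω] {P : Measure Ω}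
  {S : ℝ≥0 → Ω → ℝ}

theorem IsStableSubordinator.nonneg {α : ℝ} (hS : IsStableSubordinator α S P) (t : ℝ≥0) :
    ∀ᵐ ω ∂P, 0 ≤ S t ω := by
  filter_upwards [hS.start, hS.monotone] with ω h0 hm
  rw [← h0]
  exact hm zero_le

variable [IsProbabilityMeasure P]

/-- An atom at `0` would survive in the Laplace transform: `P(S t = 0) ≤ e^{-t l^α}` for every `l >
0`, and the right side tends to `0` as `l → ∞`. -/
theorem IsStableSubordinator.pos {α : ℝ} (hα : 0 < α) (hS : IsStableSubordinator α S P) {t : ℝ≥0}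
    (ht : 0 < t) : ∀ᵐ ω ∂P, 0 < S t ω := by
  have hmeas : MeasurableSet {ω | S t ω = 0} := hS.measurable t (measurableSet_singleton 0)
  have hle (l : ℝ) (hl : 0 < l) : P.real {ω | S t ω = 0} ≤ Real.exp (-(t * l ^ α)) := by
    rw [← hS.laplace t ht l hl, ← integral_indicator_one hmeas]
    have hm := hS.measurable t
    refine integral_mono_ae ((integrable_const 1).indicator hmeas)
      (Integrable.of_bound (by fun_prop) 1 ?_) (Eventually.of_forall fun ω => ?_)
    · filter_upwards [hS.nonneg t] with ω hω
      rw [Real.norm_of_nonneg (Real.exp_pos _).le, Real.exp_le_one_iff]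
      exact neg_nonpos.2 (mul_nonneg hl.le hω)
    · by_cases h : S t ω = 0
      · simp [Set.indicator, h]
      · simp [Set.indicator, h, (Real.exp_pos _).le]
  have hlim : Tendsto (fun l : ℝ => Real.exp (-(t * l ^ α))) atTop (𝓝 0) :=
    Real.tendsto_exp_neg_atTop_nhds_zero.comp
      ((tendsto_rpow_atTop hα).const_mul_atTop (NNReal.coe_pos.2 ht))
  have hzero : P.real {ω | S t ω = 0} = 0 :=
    le_antisymm (ge_of_tendsto hlim (by
      filter_upwards [eventually_gt_atTop 0] with l hl using hle l hl)) measureReal_nonneg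
  have hae : ∀ᵐ ω ∂P, S t ω ≠ 0 := by
    rw [ae_iff]
    simpa [measureReal_eq_zero_iff] using hzero
  filter_upwards [hae, hS.nonneg t] with ω h1 h2 using lt_of_le_of_ne h2 h1.symm

theorem IsStableSubordinator.laplace_pow {n : ℕ} (hn : 1 ≤ n)
    (hS : IsStableSubordinator (1 / (2 * n : ℝ)) S P) {t : ℝ≥0} (ht : 0 < t) (b : ℝ) :
    ∫ ω, Real.exp (-(S t ω * b ^ (2 * n))) ∂P = Real.exp (-(t * |b|)) := by
  -- The normalisation is assumed only for `l > 0`, so `b = 0` is treated apart; there both sides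
  -- are `1`.
  rcases eq_or_ne b 0 with rfl | hb
  · simp [show n ≠ 0 by omega]
  · have hpos : 0 < b ^ (2 * n) := (even_two_mul n).pow_pos hb
    have h := hS.laplace t ht (b ^ (2 * n)) hpos
    simp only [mul_comm (S t _)]
    rw [h, ← (even_two_mul n).pow_abs b, one_div, show (2 * n : ℝ) = (2 * n : ℕ) by push_cast; rfl,
      Real.pow_rpow_inv_natCast (abs_nonneg b) (by omega)]

end Subordinator

theorem mainTheorem4 (n : ℕ) (hn : 1 ≤ n) :
    -- `E e^{iβ X_{2n}(s)} = e^{-s β^{2n}}`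
    (∀ s : ℝ, 0 < s → ∀ β : ℝ,
      ∫ᵛ x, Complex.exp (Complex.I * β * x) ∂<•(pseudoLaw n s) = Real.exp (-(s * β ^ (2 * n)))) ∧
    -- `X_{2n}(S_{1/(2n)}(t))` has density `t / (π (x² + t²))`, the mixture of the densities
    -- `p_{2n}(x, s)` with respect to the law of `S_{1/(2n)}(t)`
    (∀ (Ω : Type*) [MeasurableSpace Ω] (P : Measure Ω) [IsProbabilityMeasure P]
      (S : ℝ≥0 → Ω → ℝ), IsStableSubordinator (1 / (2 * n : ℝ)) S P → ∀ t : ℝ≥0, 0 < t →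
      (∀ A : Set ℝ, MeasurableSet A →
        Integrable (fun ω => pseudoLaw n (S t ω) A) P ∧
        composedProb n P (S t) A = ∫ x in A, cauchyDensity x t) ∧
      (∀ x : ℝ, Integrable (fun ω => pseudoDensity n x (S t ω)) P ∧
        ∫ ω, pseudoDensity n x (S t ω) ∂P = cauchyDensity x t)) ∧
    -- it is a smooth solution of `∂_t^{2n} u = (-1)^n ∂_x^{2n} u` on `t > 0`
    ContDiffOn ℝ (⊤ : ℕ∞) (fun q : ℝ × ℝ => cauchyDensity q.1 q.2) {q | 0 < q.2} ∧
    (∀ x t : ℝ, 0 < t →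
      iteratedDeriv (2 * n) (fun r => cauchyDensity x r) t =
        (-1) ^ n * iteratedDeriv (2 * n) (fun y => cauchyDensity y t) x) ∧
    -- `u(x, 0) = δ(x)`
    (∀ f : ℝ →ᵇ ℝ,
      Tendsto (fun t => ∫ x, f x * cauchyDensity x t) (𝓝[>] 0) (𝓝 (f 0))) ∧
    -- the time derivatives at `t = 0+`
    (∀ k : ℕ, 0 < k → k < 2 * n → ∀ x : ℝ, x ≠ 0 →
      Tendsto (fun t => iteratedDeriv k (fun r => cauchyDensity x r) t) (𝓝[>] 0)
        (𝓝 ((-1) ^ k * (k.factorial : ℝ) / (Real.pi * |x| ^ (k + 1)) *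
          Real.cos (Real.pi * (k + 1) / 2)))) := by
  refine ⟨fun s hs b => integral_exp_pseudoLaw hn hs b, ?_, contDiffOn_cauchyDensity,
    fun x t ht => cauchyDensity_higherOrderLaplace n ht, tendsto_integral_mul_cauchyDensity,
    fun k _ _ x hx => tendsto_iteratedDeriv_cauchyDensity_time k hx⟩
  intro Ω _ P _ S hS t ht
  have hT := hS.measurable t
  have hpos := hS.pos (by positivity) ht
  have hlap := hS.laplace_pow hn ht
  have ht' : (0 : ℝ) < t := ht
  exact ⟨fun A hA => ⟨integrable_pseudoLaw_randomTime hn hT hpos hA,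
    composedProb_eq_setIntegral_cauchyDensity hn hT hpos ht' hlap hA⟩,
    fun x => ⟨integrable_pseudoDensity_randomTime hT hpos ht' hlap x,
      integral_pseudoDensity_randomTime hT hpos ht' hlap x⟩⟩
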